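/- Consider the following two ways of simulating from a coin of unknown bias $p\in[0,1]$. Quantum-to-quantum. Let $|p\rangle=\sqrt p\,|0\rangle+\sqrt{1-p}\,|1\rangle$. Let $k_0,k_1:[0,1]\to\mathbb C$ satisfy $|k_0(p)|^2+|k_1(p)|^2=1$ for all $p\in[0,1]$. The tuple $(k_0,k_1)$ is simulable if the qubit $k_0(p)|0\rangle+k_1(p)|1\rangle$ can be prepared, up to a global phase, by a finite procedure that does not depend on $p$ and succeeds with nonzero probability for every $p\in[0,1]$: starting from copies of $|p\rangle$ and constant qubits $(a|0\rangle+|1\rangle)/\sqrt{|a|^2+1}$, $a\in\mathbb C$, one may join systems prepared before, apply unitaries, and measure qubits in the computational basis, keeping a prescribed outcome. Let $$QQ=\{\,|k_0|^2:[0,1]\to[0,1] \;:\; (k_0,k_1)\text{ is simulable}\,\}.$$ Classical-to-classical. Let $CC$ be the set of functions $f$ on $[0,1]$ for which there is an algorithm (a stopping and output rule, not depending on $p$) that tosses the $p$-coin and, independently, an auxiliary fair coin, stops almost surely for every $p\in[0,1]$, and on stopping outputs $1$ with probability exactly $f(p)$ and $0$ otherwise. Then: 1. $CC\cap QQ\neq\emptyset$;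 indeed $p\mapsto p^2$ lies in $CC\cap QQ$. 2. Let $n\ge 1$ and $c_1,\dots,c_n\in(0,1)$. Every tuple $(k_0,k_1)$ with $|k_0|^2+|k_1|^2=1$ and $k_1\ne 0$ on $[0,1]$ and $k_0(p)/k_1(p)=\prod_{i=1}^n(p-c_i)$ for all $p\in[0,1]$ is simulable, and $|k_0|^2\notin CC$. Consequently the function $$p\mapsto\frac{\left|\prod_{i=1}^n(p-c_i)\right|^2}{1+\left|\prod_{i=1}^n(p-c_i)\right|^2}$$ belongs to $QQ$ but not to $CC$. In particular $QQ\not\subset CC$. 3. The function $f$ with $f(p)=\frac12$ for $p\in[0,\frac12)$ and $f(p)=\frac12p+\frac14$ for $p\in[\frac12,1]$ belongs to $CC$ but not to $QQ$. In particular $CC\not\subset QQ$. -/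

import Mathlib

open MeasureTheory ProbabilityTheory
open scoped unitInterval

noncomputable section

namespace BernoulliFactory

/-! ### Quantum states depending on an unknown bias -/

/-- A family, indexed by the bias `p ∈ [0,1]`, of amplitude vectors of `n` qubits: the amplitude of
the computational basis state `|x⟩`, `x : Fin n → Fin 2`, at `p` is `ψ p x`. -/
abbrev QFamily (n : ℕ) : Type := I → (Fin n → Fin 2) → ℂ

/-- The one-qubit family `k₀(p)|0⟩ + k₁(p)|1⟩`. -/
def qubit (k₀ k₁ : I → ℂ) : QFamily 1 :=
  fun p x => if x 0 = 0 then k₀ p else k₁ p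

/-- The quantum coin `|p⟩ = √p |0⟩ + √(1-p) |1⟩`. -/
def coin : QFamily 1 :=
  qubit (fun p => (Real.sqrt (p : ℝ) : ℂ)) (fun p => (Real.sqrt (1 - (p : ℝ)) : ℂ))

/-- The constant state `(a |0⟩ + |1⟩) / √(|a|² + 1)`. -/
def constQubit (a : ℂ) : QFamily 1 :=
  qubit (fun _ => a / (Real.sqrt (‖a‖ ^ 2 + 1) : ℂ)) (fun _ => 1 / (Real.sqrt (‖a‖ ^ 2 + 1) : ℂ))

/-- The joint state of two independent systems. -/
def tensor {m n : ℕ} (ψ : QFamily m) (φ : QFamily n) : QFamily (m + n) :=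
  fun p x => ψ p (fun i => x (Fin.castAdd n i)) * φ p (fun j => x (Fin.natAdd m j))

/-- The (unnormalized) state of the other qubits when qubit `i` is found to be `|b⟩`. -/
def project {n : ℕ} (i : Fin (n + 1)) (b : Fin 2) (ψ : QFamily (n + 1)) : QFamily n :=
  fun p x => ψ p (i.insertNth b x)

/-- The squared norm of a state. -/
def normSq {n : ℕ} (ψ : QFamily n) (p : I) : ℝ := ∑ x, ‖ψ p x‖ ^ 2

/-- The states that can be prepared, with nonzero success probability whatever the value of `p`,
in finitely many steps that do not depend on `p`, from copies of the coin `|p⟩` and from constant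
qubits, by joining systems prepared before, applying a unitary, and measuring a qubit in the
computational basis and going on only if the outcome is a prescribed one. States are considered up
to a global phase. -/
inductive Implementable : (n : ℕ) → QFamily n → Prop
  | coin : Implementable 1 coin
  | const (a : ℂ) : Implementable 1 (constQubit a)
  | tensor {m n : ℕ} {ψ : QFamily m} {φ : QFamily n} :
      Implementable m ψ → Implementable n φ → Implementable (m + n) (tensor ψ φ)
  | unitary {n : ℕ} {ψ : QFamily n} (U : Matrix (Fin n → Fin 2) (Fin n → Fin 2) ℂ) :
      U ∈ Matrix.unitaryGroup (Fin n → Fin 2) ℂ → Implementable n ψ →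
      Implementable n (fun p => U.mulVec (ψ p))
  | measure {n : ℕ} {ψ : QFamily (n + 1)} (i : Fin (n + 1)) (b : Fin 2) :
      Implementable (n + 1) ψ → (∀ p, normSq (project i b ψ) p ≠ 0) →
      Implementable n
        (fun p x => project i b ψ p x / (Real.sqrt (normSq (project i b ψ) p) : ℂ))
  | phase {n : ℕ} {ψ : QFamily n} (c : I → ℂ) :
      (∀ p, ‖c p‖ = 1) → Implementable n ψ → Implementable n (fun p x => c p * ψ p x)

/-- The tuple `(k₀, k₁)` is simulable. -/
def SimulableTuple (k₀ k₁ : I → ℂ) : Prop :=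
  (∀ p, ‖k₀ p‖ ^ 2 + ‖k₁ p‖ ^ 2 = 1) ∧ Implementable 1 (qubit k₀ k₁)

/-- The simulable functions of the quantum-to-quantum case. -/
def QQ : Set (I → ℝ) :=
  {f | ∃ k₀ k₁ : I → ℂ, SimulableTuple k₀ k₁ ∧ ∀ p, f p = ‖k₀ p‖ ^ 2}

/-! ### The classical Bernoulli factory -/

/-- The bias of a fair coin. -/
def half : I := ⟨1 / 2, by norm_num, by norm_num⟩

/-- The law of an infinite sequence of independent rounds; in each round the coin of bias `p`
(first component, `true` is heads) and an independent auxiliary fair coin (second component)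
are tossed. -/
def tossLaw (p : I) : Measure (ℕ → Bool × Bool) :=
  Measure.infinitePi fun _ =>
    (bernoulliMeasure true false p).prod (bernoulliMeasure true false half)

/-- A classical algorithm: after `n` rounds it looks at the tosses seen so far and either stops
with an output (`some b`) or asks for another round (`none`). It does not depend on `p`. -/
abbrev Algorithm : Type := (n : ℕ) → (Fin n → Bool × Bool) → Option Bool

/-- On the toss sequence `ω`, the algorithm `A` stops with output `b`. -/
def Algorithm.Outputs (A : Algorithm) (ω : ℕ → Bool × Bool) (b : Bool) : Prop :=
  ∃ n, A n (fun i => ω i) = some b ∧ ∀ m < n, A m (fun i => ω i) = none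

/-- The simulable functions of the classical-to-classical case: some algorithm stops almost surely
and outputs `true` with probability `f p`, for every bias `p ∈ [0,1]`. -/
def CC : Set (I → ℝ) :=
  {f | ∃ A : Algorithm, ∀ p : I,
    (∀ᵐ ω ∂(tossLaw p), ∃ b, A.Outputs ω b) ∧
    (tossLaw p).real {ω | A.Outputs ω true} = f p}

end BernoulliFactory

end

namespace BernoulliFactory

/-! ### Conditioning on the first round -/

/-! Membership in `CC` amounts to finding disjoint open events whose probabilities are `f p` and `1
- f p` (`mem_CC_of_events`): an open event that occurs is certain after finitely many rounds.
Bernstein approximation then gives every continuous function with values in `[1/4, 3/4]` as a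
mixture, with weights `1/2, 1/4, …`, of functions decided in boundedly many rounds
(`mem_CC_of_continuous`). This covers the piecewise linear function.

The obstruction to `CC` is positivity: for `0 < p < 1` every finite history has positive
probability, so an algorithm that never outputs `true` at one such `p` never outputs it at all
(`eq_zero_of_mem_CC`). The product function vanishes at `c i` but not at `0`.

Membership in `QQ` comes from `exists_implementable_qubit`: any two linear functionals of a prepared
state, neither identically zero and without common zero, are the amplitudes of a preparable qubit up
to a common factor. Two coins already give `p`, `1 - p` and hence `1`, so joint copies give all
products of factors `p - c i`.

The obstruction to `QQ` is analyticity: up to a common factor, the amplitudes are real analytic in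
`θ = arcsin √p` (`Implementable.exists_analytic`). If the two outcomes are equally likely on an
interval, they are so everywhere, by the identity theorem. -/

/-- The sequence of the rounds after the first one. -/
def later (ω : ℕ → Bool × Bool) : ℕ → Bool × Bool := fun n => ω (n + 1)

/-- The sequence that starts with the round `x` and goes on with `ω`. -/
def prepend (x : Bool × Bool) (ω : ℕ → Bool × Bool) : ℕ → Bool × Bool :=
  fun n => Nat.casesOn n x ω

@[fun_prop]
lemma continuous_later : Continuous later := by
  unfold later
  fun_prop

instance (p : I) : IsProbabilityMeasure (tossLaw p) := by
  unfold tossLaw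
  infer_instance

lemma measurable_prepend :
    Measurable fun z : (Bool × Bool) × (ℕ → Bool × Bool) => prepend z.1 z.2 := by
  rw [measurable_pi_iff]
  rintro (_ | n)
  · exact measurable_fst
  · exact (measurable_pi_apply n).comp measurable_snd

lemma tossLaw_eq_map_prepend (p : I) :
    tossLaw p = (((bernoulliMeasure true false p).prod (bernoulliMeasure true false half)).prod
      (tossLaw p)).map fun z => prepend z.1 z.2 := by
  symm
  refine Measure.eq_infinitePi _ fun s t ht => ?_
  classical
  -- Padding with `univ` makes the index set an initial segment, on which removing coordinate `0` is
  -- a shift.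
  set t' : ℕ → Set (Bool × Bool) := fun i => if i ∈ s then t i else Set.univ with ht'
  obtain ⟨N, hN⟩ : ∃ N, s ⊆ Finset.range (N + 1) :=
    ⟨s.sup id, fun i hi => Finset.mem_range.2 (Nat.lt_succ_of_le (Finset.le_sup (f := id) hi))⟩
  have h1 : (s : Set ℕ).pi t = ((Finset.range (N + 1) : Finset ℕ) : Set ℕ).pi t' := by
    ext ω
    simp only [Set.mem_pi, ht', Finset.mem_coe]
    constructor
    · intro h i _
      by_cases hi : i ∈ s <;> simp [hi, h]
    · intro h i hi
      simpa [hi] using h i (hN hi)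
  have h2 : (fun z : (Bool × Bool) × (ℕ → Bool × Bool) => prepend z.1 z.2) ⁻¹'
      ((Finset.range (N + 1) : Finset ℕ) : Set ℕ).pi t' =
      t' 0 ×ˢ ((Finset.range N : Finset ℕ) : Set ℕ).pi fun i => t' (i + 1) := by
    ext z
    simp only [Set.mem_preimage, Set.mem_pi, Finset.mem_coe, Finset.mem_range, Set.mem_prod]
    constructor
    · exact fun h => ⟨h 0 (by omega), fun i hi => h (i + 1) (by omega)⟩
    · rintro ⟨h, h'⟩ (_ | i) hi
      · exact h
      · exact h' i (by omega)
  have h3 : ∏ i ∈ s, ((bernoulliMeasure true false p).prod (bernoulliMeasure true false half)) (t i)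
      = ∏ i ∈ Finset.range (N + 1),
        ((bernoulliMeasure true false p).prod (bernoulliMeasure true false half)) (t' i) :=
    (Finset.prod_congr rfl fun i hi => by simp [ht', hi]).trans
      (Finset.prod_subset hN fun i _ hi => by simp [ht', hi])
  rw [h1, h3, Measure.map_apply measurable_prepend
    (MeasurableSet.pi (Finset.countable_toSet _) fun i _ => .of_discrete), h2, Measure.prod_prod,
    tossLaw, Measure.infinitePi_pi _ fun i _ => .of_discrete, Finset.prod_range_succ', mul_comm]

/-- The law of total probability with respect to the outcome of the first round. -/
lemma tossLaw_real_first (p : I) (V : Bool × Bool → Set (ℕ → Bool × Bool))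
    (hV : ∀ x, MeasurableSet (V x)) :
    (tossLaw p).real {ω | later ω ∈ V (ω 0)} =
      ((p : ℝ) * (tossLaw p).real (V (true, true)) +
        (p : ℝ) * (tossLaw p).real (V (true, false)) +
        (1 - (p : ℝ)) * (tossLaw p).real (V (false, true)) +
        (1 - (p : ℝ)) * (tossLaw p).real (V (false, false))) / 2 := by
  have hS : MeasurableSet {ω : ℕ → Bool × Bool | later ω ∈ V (ω 0)} := by
    have : {ω : ℕ → Bool × Bool | later ω ∈ V (ω 0)} =
        ⋃ x, (later ⁻¹' V x ∩ (fun ω => ω 0) ⁻¹' {x}) := by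
      ext ω; simp
    rw [this]
    exact .iUnion fun x => (continuous_later.measurable (hV x)).inter
      (measurable_pi_apply 0 (.singleton x))
  have hw (x : Bool × Bool) :
      ((bernoulliMeasure true false p).prod (bernoulliMeasure true false half)).real {x} =
        (if x.1 then (p : ℝ) else 1 - p) * (1 / 2) := by
    rw [show ({x} : Set (Bool × Bool)) = {x.1} ×ˢ {x.2} by simp, measureReal_prod_prod]
    rcases x with ⟨_ | _, _ | _⟩ <;> simp [half] <;> norm_num
  conv_lhs => rw [tossLaw_eq_map_prepend]
  rw [measureReal_def, Measure.map_apply measurable_prepend hS,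
    Measure.prod_apply (measurable_prepend hS), lintegral_fintype, ENNReal.toReal_sum]
  · simp_rw [ENNReal.toReal_mul, ← measureReal_def, hw]
    have hl (x ω) : later (prepend x ω) = ω := rfl
    have h0 (x ω) : prepend x ω 0 = x := rfl
    simp [Fintype.sum_prod_type, hl, h0]
    ring
  · exact fun x _ => ENNReal.mul_ne_top (measure_ne_top _ _) (measure_ne_top _ _)

lemma tossLaw_real_coin (p : I) {V W : Set (ℕ → Bool × Bool)}
    (hV : MeasurableSet V) (hW : MeasurableSet W) :
    (tossLaw p).real {ω | later ω ∈ if (ω 0).1 then V else W} =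
      p * (tossLaw p).real V + (1 - p) * (tossLaw p).real W := by
  rw [tossLaw_real_first p (fun x => if x.1 then V else W) 
    fun x => by split_ifs <;> assumption]
  simp
  ring

lemma tossLaw_real_fair (p : I) {V W : Set (ℕ → Bool × Bool)}
    (hV : MeasurableSet V) (hW : MeasurableSet W) :
    (tossLaw p).real {ω | later ω ∈ if (ω 0).2 then V else W} =
      ((tossLaw p).real V + (tossLaw p).real W) / 2 := by
  rw [tossLaw_real_first p (fun x => if x.2 then V else W) 
    fun x => by split_ifs <;> assumption]
  simp
  ring

/-! ### Functions realised by open events -/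

lemma isOpen_first {V : Bool × Bool → Set (ℕ → Bool × Bool)} (hV : ∀ x, IsOpen (V x)) :
    IsOpen {ω : ℕ → Bool × Bool | later ω ∈ V (ω 0)} := by
  have : {ω : ℕ → Bool × Bool | later ω ∈ V (ω 0)} =
      ⋃ x, (later ⁻¹' V x ∩ (fun ω => ω 0) ⁻¹' {x}) := by
    ext ω; simp
  rw [this]
  exact isOpen_iUnion fun x => ((hV x).preimage continuous_later).inter
    ((isOpen_discrete {x}).preimage (continuous_apply 0))

lemma isClopen_first {V : Bool × Bool → Set (ℕ → Bool × Bool)} (hV : ∀ x, IsClopen (V x)) :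
    IsClopen {ω : ℕ → Bool × Bool | later ω ∈ V (ω 0)} :=
  ⟨⟨isOpen_first (V := fun x => (V x)ᶜ) fun x => (hV x).compl.isOpen⟩,
    isOpen_first fun x => (hV x).isOpen⟩

/-- The toss sequences that begin with `h`. -/
def beginning (n : ℕ) (h : Fin n → Bool × Bool) : Set (ℕ → Bool × Bool) :=
  {ω | (fun i : Fin n => ω i) = h}

lemma exists_beginning_subset {E : Set (ℕ → Bool × Bool)} (hE : IsOpen E) {ω : ℕ → Bool × Bool}
    (hω : ω ∈ E) : ∃ n, beginning n (fun i => ω i) ⊆ E := by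
  obtain ⟨s, u, hu, hs⟩ := isOpen_pi_iff.1 hE ω hω
  refine ⟨s.sup id + 1, fun ω' h => hs fun i hi => ?_⟩
  have := congrFun h ⟨i, Nat.lt_succ_of_le (Finset.le_sup (f := id) hi)⟩
  dsimp at this
  rw [this]
  exact (hu i hi).2

open Classical in
/-- The algorithm that stops as soon as one of the events `E true`, `E false` is certain. -/
noncomputable def Algorithm.ofEvents (E : Bool → Set (ℕ → Bool × Bool)) : Algorithm := fun n h =>
  if beginning n h ⊆ E true then some true else if beginning n h ⊆ E false then some false else none

/-- The actual sequence lies in each of its beginnings, so only a true event can become certain;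
openness makes it certain at a finite time, and disjointness excludes the wrong output. -/
lemma Algorithm.ofEvents_outputs {E : Bool → Set (ℕ → Bool × Bool)} (hE : ∀ b, IsOpen (E b))
    (hd : Disjoint (E true) (E false)) (ω : ℕ → Bool × Bool) (b : Bool) :
    (Algorithm.ofEvents E).Outputs ω b ↔ ω ∈ E b := by
  classical
  have hmem (n : ℕ) : ω ∈ beginning n fun i => ω i := rfl
  have key (n : ℕ) (b : Bool) (h : Algorithm.ofEvents E n (fun i => ω i) = some b) : ω ∈ E b := by
    unfold Algorithm.ofEvents at h
    split_ifs at h with h1 h2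
    · cases h; exact h1 (hmem n)
    · cases h; exact h2 (hmem n)
  constructor
  · rintro ⟨n, hn, -⟩
    exact key n b hn
  · intro hω
    have hex : ∃ n, Algorithm.ofEvents E n (fun i => ω i) ≠ none := by
      obtain ⟨n, hn⟩ := exists_beginning_subset (hE b) hω
      refine ⟨n, ?_⟩
      unfold Algorithm.ofEvents
      cases b <;> simp [hn]
      split_ifs <;> simp
    refine ⟨Nat.find hex, ?_, fun m hm => by simpa using Nat.find_min hex hm⟩
    obtain ⟨b', hb'⟩ := Option.ne_none_iff_exists'.1 (Nat.find_spec hex)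
    rw [hb']
    have h' := key _ _ hb'
    rw [Set.disjoint_left] at hd
    cases b <;> cases b' <;> first | rfl | exact absurd hω (hd h') | exact absurd h' (hd hω)

lemma mem_CC_of_events {f : I → ℝ} (E : Bool → Set (ℕ → Bool × Bool)) (hE : ∀ b, IsOpen (E b))
    (hd : Disjoint (E true) (E false)) (h1 : ∀ p, (tossLaw p).real (E true) = f p)
    (h0 : ∀ p, (tossLaw p).real (E false) = 1 - f p) : f ∈ CC := by
  refine ⟨Algorithm.ofEvents E, fun p => ⟨?_, ?_⟩⟩
  · simp_rw [Algorithm.ofEvents_outputs hE hd]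
    have hu (ω) : (∃ b, ω ∈ E b) ↔ ω ∈ E true ∪ E false := by
      simp [or_comm]
    simp_rw [hu]
    have hm : MeasurableSet (E true ∪ E false) := ((hE _).union (hE _)).measurableSet
    rw [ae_iff_prob_eq_one hm.mem, Set.ofPred_mem_eq]
    have : (tossLaw p).real (E true ∪ E false) = 1 := by
      rw [measureReal_union hd (hE _).measurableSet, h1, h0]
      ring
    rw [measureReal_def] at this
    rw [← ENNReal.ofReal_toReal (measure_ne_top (tossLaw p) (E true ∪ E false)), this,
      ENNReal.ofReal_one]
  · simp_rw [Algorithm.ofEvents_outputs hE hd]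
    exact h1 p

/-! ### Functions that can be simulated in a bounded number of rounds -/

/-- The continuous functions that are the probability of an event that is decided by boundedly
many rounds. -/
def Bounded (g : C(I, ℝ)) : Prop :=
  ∃ U : Set (ℕ → Bool × Bool), IsClopen U ∧ ∀ p, (tossLaw p).real U = g p

lemma Bounded.mem_CC {g : C(I, ℝ)} (hg : Bounded g) : (g : I → ℝ) ∈ CC := by
  obtain ⟨U, hU, h⟩ := hg
  refine mem_CC_of_events (fun b => if b then U else Uᶜ) ?_ ?_ (by simpa using h) fun p => ?_
  · rintro (_ | _)
    · simpa using hU.isClosed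
    · simpa using hU.isOpen
  · simpa using disjoint_compl_right
  · simp [probReal_compl_eq_one_sub hU.isOpen.measurableSet, h]

lemma bounded_zero : Bounded 0 := ⟨∅, isClopen_empty, by simp⟩

lemma bounded_one : Bounded 1 := ⟨Set.univ, isClopen_univ, by simp⟩

lemma Bounded.nonneg {g : C(I, ℝ)} (hg : Bounded g) (p : I) : 0 ≤ g p := by
  obtain ⟨U, -, h⟩ := hg
  rw [← h]
  exact measureReal_nonneg

/-- The bias as a continuous function. -/
def bias : C(I, ℝ) := ⟨fun p => p, by fun_prop⟩

@[simp]
lemma bias_apply (p : I) : bias p = p := rfl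

/-- One toss of the coin chooses which of the two events the remaining rounds must realise. -/
lemma Bounded.coin {g h : C(I, ℝ)} (hg : Bounded g) (hh : Bounded h) :
    Bounded (bias * g + (1 - bias) * h) := by
  obtain ⟨U, hU, hgU⟩ := hg
  obtain ⟨V, hV, hhV⟩ := hh
  refine ⟨_, isClopen_first (V := fun x => if x.1 then U else V) fun x => ?_, fun p => ?_⟩
  · split_ifs <;> assumption
  · rw [tossLaw_real_coin p hU.isOpen.measurableSet hV.isOpen.measurableSet, hgU, hhV]
    simp

lemma Bounded.fair {g h : C(I, ℝ)} (hg : Bounded g) (hh : Bounded h) :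
    Bounded ((1 / 2 : ℝ) • (g + h)) := by
  obtain ⟨U, hU, hgU⟩ := hg
  obtain ⟨V, hV, hhV⟩ := hh
  refine ⟨_, isClopen_first (V := fun x => if x.2 then U else V) fun x => ?_, fun p => ?_⟩
  · split_ifs <;> assumption
  · rw [tossLaw_real_fair p hU.isOpen.measurableSet hV.isOpen.measurableSet, hgU, hhV]
    simp
    ring

lemma sq_mem_CC : (fun p : I => (p : ℝ) ^ 2) ∈ CC := by
  have := ((bounded_one.coin bounded_zero).coin bounded_zero).mem_CC
  convert this using 2 with p
  simp
  ring

/-! ### Density of the functions that can be simulated in boundedly many rounds -/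

/-- Each fair toss handles one binary digit of `a`; the remaining digits are those of `2 * a` or `2
* a - 1`. -/
lemma exists_bounded_near_const (m : ℕ) (a : ℝ) (h0 : 0 ≤ a) (h1 : a ≤ 1) :
    ∃ g, Bounded g ∧ ∀ p, |g p - a| ≤ (1 / 2) ^ m := by
  induction m generalizing a with
  | zero => exact ⟨0, bounded_zero, fun p => by simpa [abs_of_nonneg h0] using h1⟩
  | succ m ih =>
    rcases le_total a (1 / 2) with ha | ha
    · obtain ⟨g, hg, h⟩ := ih (2 * a) (by linarith) (by linarith)
      refine ⟨_, hg.fair bounded_zero, fun p => ?_⟩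
      have := h p
      rw [abs_le] at this ⊢
      simp only [pow_succ, ContinuousMap.smul_apply, ContinuousMap.add_apply,
        ContinuousMap.zero_apply, smul_eq_mul]
      constructor <;> linarith
    · obtain ⟨g, hg, h⟩ := ih (2 * a - 1) (by linarith) (by linarith)
      refine ⟨_, hg.fair bounded_one, fun p => ?_⟩
      have := h p
      rw [abs_le] at this ⊢
      simp only [pow_succ, ContinuousMap.smul_apply, ContinuousMap.add_apply,
        ContinuousMap.one_apply, smul_eq_mul]
      constructor <;> linarith

/-- Pascal's rule, read as conditioning on the first toss: heads shifts the coefficients by one. -/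
lemma sum_bernstein_succ (N : ℕ) (a : ℕ → ℝ) (p : ℝ) :
    ∑ j ∈ Finset.range (N + 2), a j * ((N + 1).choose j * p ^ j * (1 - p) ^ (N + 1 - j)) =
      p * ∑ j ∈ Finset.range (N + 1), a (j + 1) * (N.choose j * p ^ j * (1 - p) ^ (N - j)) +
      (1 - p) * ∑ j ∈ Finset.range (N + 1), a j * (N.choose j * p ^ j * (1 - p) ^ (N - j)) := by
  have h2 : (1 - p) * ∑ j ∈ Finset.range (N + 1), a j * (N.choose j * p ^ j * (1 - p) ^ (N - j)) =
      ∑ j ∈ Finset.range (N + 2), a j * (N.choose j * p ^ j * (1 - p) ^ (N + 1 - j)) := by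
    rw [Finset.sum_range_succ _ (N + 1), Finset.mul_sum]
    simp only [Nat.choose_succ_self, Nat.cast_zero, zero_mul, mul_zero, add_zero]
    refine Finset.sum_congr rfl fun j hj => ?_
    rw [Nat.succ_sub (Nat.lt_succ_iff.1 (Finset.mem_range.1 hj)), pow_succ]
    ring
  rw [h2, Finset.sum_range_succ', Finset.sum_range_succ' _ (N + 1), ← add_assoc, Finset.mul_sum,
    ← Finset.sum_add_distrib]
  congr 1
  · refine Finset.sum_congr rfl fun j _ => ?_
    rw [Nat.choose_succ_succ, Nat.add_sub_add_right]
    push_cast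
    ring
  · simp

/-- Toss the coin `N` times and, after `j` heads, simulate `a j` approximately. Conditioning on a
toss is a convex combination, so the error does not grow with `N`. -/
lemma exists_bounded_near_sum (N : ℕ) (a : ℕ → ℝ) (ha : ∀ j, a j ∈ Set.Icc (0 : ℝ) 1) {ε : ℝ}
    (hε : 0 < ε) : ∃ g, Bounded g ∧ ∀ p : I, |g p - ∑ j ∈ Finset.range (N + 1),
      a j * (N.choose j * (p : ℝ) ^ j * (1 - (p : ℝ)) ^ (N - j))| ≤ ε := by
  induction N generalizing a with
  | zero =>
    obtain ⟨m, hm⟩ := exists_pow_lt_of_lt_one hε (show (1 / 2 : ℝ) < 1 by norm_num)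
    obtain ⟨g, hg, h⟩ := exists_bounded_near_const m (a 0) (ha 0).1 (ha 0).2
    exact ⟨g, hg, fun p => by simpa using (h p).trans hm.le⟩
  | succ N ih =>
    obtain ⟨g, hg, h⟩ := ih (fun j => a (j + 1)) fun j => ha _
    obtain ⟨g', hg', h'⟩ := ih a ha
    refine ⟨_, hg.coin hg', fun p => ?_⟩
    rw [sum_bernstein_succ]
    specialize h p
    specialize h' p
    set S := ∑ j ∈ Finset.range (N + 1),
      a (j + 1) * (N.choose j * (p : ℝ) ^ j * (1 - (p : ℝ)) ^ (N - j))
    set T := ∑ j ∈ Finset.range (N + 1), a j * (N.choose j * (p : ℝ) ^ j * (1 - (p : ℝ)) ^ (N - j))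
    have hp0 := p.2.1
    have hp1 := p.2.2
    simp only [ContinuousMap.add_apply, ContinuousMap.mul_apply, ContinuousMap.sub_apply,
      ContinuousMap.one_apply, bias_apply]
    rw [abs_le] at *
    constructor <;> nlinarith

lemma exists_bounded_near (F : C(I, ℝ)) (hF : ∀ p, F p ∈ Set.Icc (0 : ℝ) 1) {ε : ℝ} (hε : 0 < ε) :
    ∃ g, Bounded g ∧ ∀ p, |g p - F p| ≤ ε := by
  obtain ⟨N, hN⟩ := ((Metric.tendsto_nhds.1 (bernsteinApproximation_uniform F)) (ε / 2)
    (half_pos hε)).exists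
  obtain ⟨g, hg, h⟩ := exists_bounded_near_sum N
    -- The coefficients are the sampled values of `F`; the default `0` lies beyond the range of the
    -- sum.
    (fun j => if hj : j < N + 1 then F (bernstein.z ⟨j, hj⟩) else 0)
    (fun j => by
      split_ifs
      · exact hF _
      · simp) (half_pos hε)
  refine ⟨g, hg, fun p => ?_⟩
  have h1 := h p
  have h2 := (ContinuousMap.dist_lt_iff (half_pos hε)).1 hN p
  rw [Finset.sum_range] at h1
  rw [Real.dist_eq, bernsteinApproximation.apply] at h2
  simp only [Fin.is_lt, dite_true, Fin.eta] at h1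
  simp only [bernstein_apply, smul_eq_mul] at h2
  simp_rw [mul_comm (F _)] at h1
  rw [abs_le] at *
  rw [abs_lt] at h2
  constructor <;> linarith

/-! ### Mixing a sequence of functions with the weights `1/2, 1/4, 1/8, …` -/

/-- The first `k` fair tosses are tails, the next one is heads, and the rounds after that lie
in `U`. -/
def stage : ℕ → Set (ℕ → Bool × Bool) → Set (ℕ → Bool × Bool)
  | 0, U => {ω | later ω ∈ if (ω 0).2 then U else ∅}
  | k + 1, U => {ω | later ω ∈ if (ω 0).2 then ∅ else stage k U}

lemma isOpen_stage (k : ℕ) {U : Set (ℕ → Bool × Bool)} (hU : IsOpen U) : IsOpen (stage k U) := by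
  induction k with
  | zero =>
    refine isOpen_first (V := fun x => if x.2 then U else ∅) fun x => ?_
    split_ifs
    exacts [hU, isOpen_empty]
  | succ k ih =>
    refine isOpen_first (V := fun x => if x.2 then ∅ else stage k U) fun x => ?_
    split_ifs
    exacts [isOpen_empty, ih]

lemma tossLaw_real_stage (p : I) (k : ℕ) {U : Set (ℕ → Bool × Bool)} (hU : IsOpen U) :
    (tossLaw p).real (stage k U) = (1 / 2) ^ (k + 1) * (tossLaw p).real U := by
  induction k with
  | zero =>
    rw [stage, tossLaw_real_fair p hU.measurableSet .empty]
    simp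
    ring
  | succ k ih =>
    rw [stage, tossLaw_real_fair p .empty (isOpen_stage k hU).measurableSet, ih, pow_succ _ (k + 1)]
    simp
    ring

/-- The index of a stage is the number of fair tails before the first heads, so the sequence
determines it. The first conclusion separates different stages; the second separates the two outputs
within one stage. -/
lemma eq_of_mem_stage {ω : ℕ → Bool × Bool} {j k : ℕ} {U V : Set (ℕ → Bool × Bool)}
    (hj : ω ∈ stage j U) (hk : ω ∈ stage k V) : j = k ∧ (U ∩ V).Nonempty := by
  induction j generalizing k ω with
  | zero =>
    cases k with
    | zero =>
      simp only [stage, Set.mem_ofPred_eq] at hj hk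
      split_ifs at hj hk
      · exact ⟨rfl, _, hj, hk⟩
      · exact hj.elim
    | succ k =>
      simp only [stage, Set.mem_ofPred_eq] at hj hk
      split_ifs at hj hk
      · exact hk.elim
      · exact hj.elim
  | succ j ih =>
    cases k with
    | zero =>
      simp only [stage, Set.mem_ofPred_eq] at hj hk
      split_ifs at hj hk
      · exact hj.elim
      · exact hk.elim
    | succ k =>
      simp only [stage, Set.mem_ofPred_eq] at hj hk
      split_ifs at hj hk
      · exact hj.elim
      · exact ⟨congrArg _ (ih hj hk).1, (ih hj hk).2⟩

lemma tossLaw_real_iUnion_stage (p : I) {U : ℕ → Set (ℕ → Bool × Bool)} (hU : ∀ k, IsOpen (U k))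
    {a : ℝ} (h : HasSum (fun k => (1 / 2) ^ (k + 1) * (tossLaw p).real (U k)) a) :
    (tossLaw p).real (⋃ k, stage k (U k)) = a := by
  rw [measureReal_def, measure_iUnion, ENNReal.tsum_toReal_eq fun k => measure_ne_top _ _]
  · simp_rw [← measureReal_def, tossLaw_real_stage p _ (hU _)]
    exact h.tsum_eq
  · exact fun j k hjk => Set.disjoint_left.2 fun ω hj hk => hjk (eq_of_mem_stage hj hk).1
  · exact fun k => (isOpen_stage k (hU k)).measurableSet

/-- Fair tosses select `k` with probability `(1 / 2) ^ (k + 1)`, then `g k` is simulated. -/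
lemma mem_CC_of_hasSum {f : I → ℝ} (g : ℕ → C(I, ℝ)) (hg : ∀ k, Bounded (g k))
    (h : ∀ p, HasSum (fun k => (1 / 2) ^ (k + 1) * g k p) (f p)) : f ∈ CC := by
  choose U hU hgU using hg
  refine mem_CC_of_events (fun b => ⋃ k, stage k (if b then U k else (U k)ᶜ)) (fun b => ?_) ?_
    (fun p => ?_) fun p => ?_
  · refine isOpen_iUnion fun k => isOpen_stage k ?_
    split_ifs
    exacts [(hU k).isOpen, (hU k).compl.isOpen]
  · rw [Set.disjoint_left]
    intro ω h1 h0
    obtain ⟨j, hj⟩ := Set.mem_iUnion.1 h1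
    obtain ⟨k, hk⟩ := Set.mem_iUnion.1 h0
    obtain ⟨rfl, h'⟩ := eq_of_mem_stage hj hk
    simp at h'
  · refine tossLaw_real_iUnion_stage p (fun k => ?_) ?_
    · simpa using (hU k).isOpen
    · simpa [hgU] using h p
  · refine tossLaw_real_iUnion_stage p (fun k => ?_) ?_
    · simpa using (hU k).isClosed
    · have h1 : HasSum (fun k : ℕ => (1 / 2 : ℝ) ^ (k + 1)) 1 := by
        simpa [pow_succ, div_eq_mul_inv] using hasSum_geometric_two.mul_right (1 / 2 : ℝ)
      have h2 := h1.sub (h p)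
      simp only [Bool.false_eq_true, if_false]
      simp_rw [probReal_compl_eq_one_sub (hU _).isOpen.measurableSet, hgU, mul_one_sub]
      exact h2

/-- A continuous function with values in `[1/4, 3/4]` is simulable. -/
theorem mem_CC_of_continuous (F : C(I, ℝ)) (hF : ∀ p, F p ∈ Set.Icc (1 / 4 : ℝ) (3 / 4)) :
    (F : I → ℝ) ∈ CC := by
  have hstep (G : {G : C(I, ℝ) // ∀ p, G p ∈ Set.Icc (1 / 4 : ℝ) (3 / 4)}) :
      ∃ g, Bounded g ∧ ∀ p, ((2 : ℝ) • G.1 - g) p ∈ Set.Icc (1 / 4 : ℝ) (3 / 4) := by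
    -- The target `(3/2) G - 1/4` lies in `[1/8, 7/8]`. If `g` were equal to it, `2 G - g` would be
    -- `G/2 + 1/4`, in `[3/8, 5/8]`; an error of `1/8` keeps it in `[1/4, 3/4]`, so the step can be
    -- iterated.
    obtain ⟨g, hg, h⟩ := exists_bounded_near ((3 / 2 : ℝ) • G.1 - (1 / 4 : ℝ) • 1) (fun p => by
      have := G.2 p
      simp only [ContinuousMap.sub_apply, ContinuousMap.smul_apply, ContinuousMap.one_apply,
        smul_eq_mul, Set.mem_Icc] at this ⊢
      constructor <;> linarith) (ε := 1 / 8) (by norm_num)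
    refine ⟨g, hg, fun p => ?_⟩
    have h1 := G.2 p
    have h2 := h p
    simp only [ContinuousMap.sub_apply, ContinuousMap.smul_apply, ContinuousMap.one_apply,
      smul_eq_mul, Set.mem_Icc, abs_le] at h1 h2 ⊢
    constructor <;> linarith
  choose g hg hstep using hstep
  -- `G n` is the remainder after `n` steps, scaled by `2 ^ n`; it stays bounded, so the true
  -- remainder tends to `0`.
  let G : ℕ → {G : C(I, ℝ) // ∀ p, G p ∈ Set.Icc (1 / 4 : ℝ) (3 / 4)} :=
    fun k => Nat.rec ⟨F, hF⟩ (fun _ G => ⟨(2 : ℝ) • G.1 - g G, hstep G⟩) k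
  have hG (k : ℕ) : (G (k + 1)).1 = (2 : ℝ) • (G k).1 - g (G k) := rfl
  refine mem_CC_of_hasSum (fun k => g (G k)) (fun k => hg _) fun p => ?_
  have hsum (n : ℕ) : ∑ k ∈ Finset.range n, (1 / 2 : ℝ) ^ (k + 1) * g (G k) p =
      F p - (1 / 2) ^ n * (G n).1 p := by
    induction n with
    | zero => simp [G]
    | succ n ih =>
      rw [Finset.sum_range_succ, ih, hG]
      simp
      ring
  rw [hasSum_iff_tendsto_nat_of_nonneg fun k => mul_nonneg (by positivity) ((hg _).nonneg p)]
  simp_rw [hsum]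
  have h0 : Filter.Tendsto (fun n => (1 / 2 : ℝ) ^ n * (G n).1 p) Filter.atTop (nhds 0) := by
    refine squeeze_zero (fun n => mul_nonneg (by positivity) ?_) (fun n => ?_)
      (tendsto_pow_atTop_nhds_zero_of_lt_one (r := (1 / 2 : ℝ)) (by norm_num) (by norm_num))
    · linarith [((G n).2 p).1]
    · exact mul_le_of_le_one_right (by positivity) (by linarith [((G n).2 p).2])
  simpa using h0.const_sub (F p)

lemma piecewise_mem_CC :
    (fun p : I => if (p : ℝ) < 1 / 2 then (1 / 2 : ℝ) else 1 / 2 * (p : ℝ) + 1 / 4) ∈ CC := by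
  -- With `max` the function is visibly continuous, with values in `[1/2, 3/4]`.
  have := mem_CC_of_continuous ⟨fun p : I => 1 / 2 * max (1 / 2 : ℝ) p + 1 / 4, by fun_prop⟩
    fun p => by
      have h1 := le_max_left (1 / 2 : ℝ) p
      have h2 : max (1 / 2 : ℝ) p ≤ 1 := max_le (by norm_num) p.2.2
      simp only [ContinuousMap.coe_mk, Set.mem_Icc]
      constructor <;> linarith
  convert this using 2 with p
  simp only [ContinuousMap.coe_mk]
  split_ifs with h
  · rw [max_eq_left h.le]
    norm_num
  · rw [max_eq_right (not_lt.1 h)]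

/-! ### A simulable function that vanishes inside `(0,1)` vanishes everywhere -/

lemma tossLaw_beginning_ne_zero {p : I} (hp0 : 0 < (p : ℝ)) (hp1 : (p : ℝ) < 1) (n : ℕ)
    (ω : ℕ → Bool × Bool) : tossLaw p (beginning n fun i => ω i) ≠ 0 := by
  have h : beginning n (fun i => ω i) =
      ((Finset.range n : Finset ℕ) : Set ℕ).pi fun i => {ω i} := by
    ext ω'
    simp only [beginning, Set.mem_ofPred_eq, funext_iff, Set.mem_pi, Finset.mem_coe,
      Finset.mem_range, Set.mem_singleton_iff]
    exact ⟨fun h i hi => h ⟨i, hi⟩, fun h i => h i i.2⟩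
  rw [h, tossLaw, Measure.infinitePi_pi _ fun i _ => .singleton _]
  refine Finset.prod_ne_zero_iff.2 fun i _ => ?_
  rw [show ({ω i} : Set (Bool × Bool)) = {(ω i).1} ×ˢ {(ω i).2} by simp, Measure.prod_prod]
  have key (q : I) (hq0 : 0 < (q : ℝ)) (hq1 : (q : ℝ) < 1) (b : Bool) :
      bernoulliMeasure true false q {b} ≠ 0 := by
    intro h
    have : (bernoulliMeasure true false q).real {b} = 0 := by rw [measureReal_def, h]; rfl
    cases b
    · simp at this
      linarith
    · simp at this
      simp [this] at hq0
  exact mul_ne_zero (key p hp0 hp1 _) (key half (by norm_num [half]) (by norm_num [half]) _)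

/-- One sequence with output `true` would give that output on a whole cylinder, which has positive
probability at the interior point `p`. Hence no such sequence exists, whatever the bias. -/
lemma eq_zero_of_mem_CC {f : I → ℝ} (hf : f ∈ CC) {p : I} (hp0 : 0 < (p : ℝ)) (hp1 : (p : ℝ) < 1)
    (hfp : f p = 0) (q : I) : f q = 0 := by
  obtain ⟨A, hA⟩ := hf
  have hempty : {ω | A.Outputs ω true} = ∅ := by
    rw [Set.eq_empty_iff_forall_notMem]
    rintro ω ⟨n, hn, hmin⟩
    refine tossLaw_beginning_ne_zero hp0 hp1 n ω (measure_mono_null (t := {ω | A.Outputs ω true})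
      (fun ω' hω' => ?_) ?_)
    · have hag (m : ℕ) (hm : m ≤ n) : (fun i : Fin m => ω' i) = fun i : Fin m => ω i :=
        funext fun i => congrFun hω' (Fin.castLE hm i)
      exact ⟨n, by rw [hag n le_rfl, hn], fun m hm => by rw [hag m hm.le, hmin m hm]⟩
    · have := (hA p).2
      rwa [hfp, measureReal_eq_zero_iff] at this
  rw [← (hA q).2, hempty, measureReal_empty]

/-! ### Prepared states are normalized -/

lemma sum_append {m n : ℕ} {M : Type*} [AddCommMonoid M] (f : (Fin (m + n) → Fin 2) → M) :
    ∑ x, f x = ∑ y : Fin m → Fin 2, ∑ z : Fin n → Fin 2, f (Fin.append y z) := by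
  rw [← Fintype.sum_prod_type' (f := fun y z => f (Fin.append y z))]
  exact (Fintype.sum_equiv (Fin.appendEquiv m n) _ _ fun _ => rfl).symm

lemma sum_append_one {n : ℕ} {M : Type*} [AddCommMonoid M] (f : (Fin (n + 1) → Fin 2) → M) :
    ∑ x, f x = ∑ y : Fin n → Fin 2, ∑ b : Fin 2, f (Fin.append y fun _ => b) := by
  rw [sum_append]
  exact Finset.sum_congr rfl fun y _ =>
    ((Equiv.funUnique (Fin 1) (Fin 2)).symm.sum_comp fun z => f (Fin.append y z)).symm

lemma normSq_qubit (k₀ k₁ : I → ℂ) (p : I) :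
    normSq (qubit k₀ k₁) p = ‖k₀ p‖ ^ 2 + ‖k₁ p‖ ^ 2 := by
  rw [normSq, ← (Equiv.funUnique (Fin 1) (Fin 2)).symm.sum_comp]
  simp [qubit]

lemma normSq_smul {n : ℕ} (c : I → ℂ) (ψ : QFamily n) (p : I) :
    normSq (fun p x => c p * ψ p x) p = ‖c p‖ ^ 2 * normSq ψ p := by
  simp [normSq, mul_pow, Finset.mul_sum]

lemma normSq_nonneg {n : ℕ} (ψ : QFamily n) (p : I) : 0 ≤ normSq ψ p :=
  Finset.sum_nonneg fun _ _ => by positivity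

lemma normSq_normalize {n : ℕ} {ψ : QFamily n} {p : I} (h : normSq ψ p ≠ 0) :
    normSq (fun p x => ψ p x / (Real.sqrt (normSq ψ p) : ℂ)) p = 1 := by
  simp_rw [div_eq_inv_mul]
  rw [normSq_smul (fun p => ((Real.sqrt (normSq ψ p) : ℂ))⁻¹)]
  simp [Real.sq_sqrt (normSq_nonneg ψ p), h]

lemma normSq_unitary {n : ℕ} {ψ : QFamily n} {U : Matrix (Fin n → Fin 2) (Fin n → Fin 2) ℂ}
    (hU : U ∈ Matrix.unitaryGroup (Fin n → Fin 2) ℂ) (p : I) :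
    normSq (fun p => U.mulVec (ψ p)) p = normSq ψ p := by
  have h (v : (Fin n → Fin 2) → ℂ) : ((∑ x, ‖v x‖ ^ 2 : ℝ) : ℂ) = dotProduct (star v) v := by
    simp [dotProduct, Complex.conj_mul']
  have : (normSq (fun p => U.mulVec (ψ p)) p : ℂ) = (normSq ψ p : ℂ) := by
    rw [normSq, normSq, h, h, Matrix.star_mulVec, Matrix.dotProduct_mulVec, Matrix.vecMul_vecMul,
      ← Matrix.star_eq_conjTranspose, Matrix.mem_unitaryGroup_iff'.1 hU, Matrix.vecMul_one]
  exact_mod_cast this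

/-- This fixes the modulus of the unknown factor `r` left by the measurements below. -/
lemma Implementable.normSq_eq_one {n : ℕ} {ψ : QFamily n} (h : Implementable n ψ) (p : I) :
    normSq ψ p = 1 := by
  induction h with
  | coin =>
    have h0 := p.2.1
    have h1 := p.2.2
    simp [BernoulliFactory.coin, normSq_qubit, Real.sq_sqrt, h0, h1]
  | const a =>
    have h : (0 : ℝ) < ‖a‖ ^ 2 + 1 := by positivity
    simp only [constQubit, normSq_qubit, norm_div, Complex.norm_real, div_pow, norm_one,
      Real.norm_eq_abs, sq_abs, Real.sq_sqrt h.le]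
    field_simp
  | @tensor m n ψ φ _ _ hψ hφ =>
    have : normSq (BernoulliFactory.tensor ψ φ) p = normSq ψ p * normSq φ p := by
      simp [normSq, sum_append, BernoulliFactory.tensor, Finset.sum_mul_sum, mul_pow]
    rw [this, hψ, hφ, one_mul]
  | unitary U hU _ h => rw [normSq_unitary hU, h]
  | measure i b _ hne _ => exact normSq_normalize (hne p)
  | phase c hc _ h => rw [normSq_smul, hc, h]; simp

/-! ### Reading off two linear functionals of a prepared state -/

/-- Measuring all qubits but one. -/
lemma exists_measure_all (n : ℕ) : ∃ y : (Fin 1 → Fin 2) → (Fin (n + 1) → Fin 2),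
    Function.Injective y ∧ ∀ ψ : QFamily (n + 1), Implementable (n + 1) ψ →
      (∀ p, ∃ x, ψ p (y x) ≠ 0) →
      ∃ r : I → ℂ, Implementable 1 fun p x => r p * ψ p (y x) := by
  induction n with
  | zero => exact ⟨id, Function.injective_id, fun ψ hψ _ => ⟨fun _ => 1, by simpa using hψ⟩⟩
  | succ n ih =>
    obtain ⟨y, hy, h⟩ := ih
    refine ⟨fun x => (0 : Fin (n + 2)).insertNth 0 (y x),
      fun x x' hxx => hy (Fin.insertNth_right_injective (α := fun _ => Fin 2) (x := 0) hxx),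
      fun ψ hψ hne => ?_⟩
    -- The amplitude at `y x`, nonzero for some `x`, survives the measurement, so the prescribed
    -- outcome has positive probability.
    have hN (p : I) : normSq (project 0 0 ψ) p ≠ 0 := by
      obtain ⟨x, hx⟩ := hne p
      refine (Finset.sum_pos' (fun _ _ => by positivity) ⟨y x, Finset.mem_univ _, ?_⟩).ne'
      have : project 0 0 ψ p (y x) ≠ 0 := hx
      positivity
    have hs (p : I) : (Real.sqrt (normSq (project 0 0 ψ) p) : ℂ) ≠ 0 := by
      exact_mod_cast (Real.sqrt_pos.2 ((normSq_nonneg _ p).lt_of_ne' (hN p))).ne'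
    obtain ⟨r, hr⟩ := h _ (hψ.measure 0 0 hN) fun p => by
      obtain ⟨x, hx⟩ := hne p
      exact ⟨x, div_ne_zero hx (hs p)⟩
    refine ⟨fun p => r p / (Real.sqrt (normSq (project 0 0 ψ) p) : ℂ), ?_⟩
    convert hr using 3
    simp only [project]
    ring

/-- Two orthonormal vectors are two rows of a unitary matrix. -/
lemma exists_unitary_rows {ι : Type*} [Fintype ι] [DecidableEq ι] (e : Fin 2 → ι)
    (he : Function.Injective e) (v : Fin 2 → ι → ℂ)
    (h : ∀ b c, ∑ i, v b i * star (v c i) = if b = c then 1 else 0) :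
    ∃ U ∈ Matrix.unitaryGroup ι ℂ, ∀ b, U (e b) = v b := by
  -- The values of `w` off the range of `e` are irrelevant; the basis extension replaces them.
  let w : ι → EuclideanSpace ℂ ι := fun i => WithLp.toLp 2 (Function.extend e v 0 i)
  have hw (b) : w (e b) = WithLp.toLp 2 (v b) := by simp [w, he.extend_apply]
  have hon : Orthonormal ℂ ((Set.range e).domRestrict w) := by
    rw [orthonormal_iff_ite]
    rintro ⟨_, b, rfl⟩ ⟨_, c, rfl⟩
    have hbc : (⟨e b, b, rfl⟩ : Set.range e) = ⟨e c, c, rfl⟩ ↔ c = b :=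
      Subtype.ext_iff.trans (he.eq_iff.trans eq_comm)
    have hgoal : inner ℂ (w (e b)) (w (e c)) = if c = b then 1 else 0 := by
      rw [← h c b, hw, hw, PiLp.inner_apply]
      exact Finset.sum_congr rfl fun i _ => by simp
    exact hgoal.trans (if_congr hbc.symm rfl rfl)
  obtain ⟨B, hB⟩ := hon.exists_orthonormalBasis_extension_of_card_eq (by simp)
  refine ⟨Matrix.of fun i j => B i j, ?_, fun b => ?_⟩
  · rw [Matrix.mem_unitaryGroup_iff]
    ext i j
    have := orthonormal_iff_ite.1 B.orthonormal j i
    rw [PiLp.inner_apply] at this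
    rw [Matrix.mul_apply, Matrix.one_apply]
    simp only [Matrix.star_apply, eq_comm (a := i), ← this]
    exact Finset.sum_congr rfl fun i _ => by simp
  · ext j
    rw [Matrix.of_apply, hB _ ⟨b, rfl⟩, hw]

/-- `f` is a linear functional of the state `ψ`. -/
def LinearIn {n : ℕ} (ψ : QFamily n) (f : I → ℂ) : Prop :=
  ∃ w : (Fin n → Fin 2) → ℂ, ∀ p, f p = ∑ x, w x * ψ p x

lemma LinearIn.add {n : ℕ} {ψ : QFamily n} {f g : I → ℂ} (hf : LinearIn ψ f) (hg : LinearIn ψ g) :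
    LinearIn ψ fun p => f p + g p := by
  obtain ⟨v, hv⟩ := hf
  obtain ⟨w, hw⟩ := hg
  exact ⟨fun x => v x + w x, fun p => by simp [hv, hw, add_mul, Finset.sum_add_distrib]⟩

lemma LinearIn.const_mul {n : ℕ} {ψ : QFamily n} {f : I → ℂ} (hf : LinearIn ψ f) (c : ℂ) :
    LinearIn ψ fun p => c * f p := by
  obtain ⟨v, hv⟩ := hf
  exact ⟨fun x => c * v x, fun p => by simp [hv, Finset.mul_sum, mul_assoc]⟩

lemma LinearIn.apply {n : ℕ} (ψ : QFamily n) (x : Fin n → Fin 2) : LinearIn ψ fun p => ψ p x :=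
  ⟨Pi.single x 1, fun p => by simp [Pi.single_apply]⟩

lemma LinearIn.mul {m n : ℕ} {ψ : QFamily m} {φ : QFamily n} {f g : I → ℂ} (hf : LinearIn ψ f)
    (hg : LinearIn φ g) : LinearIn (tensor ψ φ) fun p => f p * g p := by
  obtain ⟨v, hv⟩ := hf
  obtain ⟨w, hw⟩ := hg
  refine ⟨fun x => v (fun i => x (Fin.castAdd n i)) * w (fun j => x (Fin.natAdd m j)), fun p => ?_⟩
  simp only [sum_append, tensor, Fin.append_left, Fin.append_right, hv, hw, Finset.sum_mul_sum]
  exact Finset.sum_congr rfl fun _ _ => Finset.sum_congr rfl fun _ _ => by ring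

/-- The coefficient vectors of `f₀` and `f₁` need not be orthogonal or of equal length. An auxiliary
qubit, read as `0` for one and `1` for the other, makes them orthogonal, and its amplitudes
compensate for the normalization. A unitary with these two rows puts both functionals on basis
states, and measuring the other qubits leaves the desired qubit. -/
lemma exists_implementable_qubit {n : ℕ} {ψ : QFamily n} (hψ : Implementable n ψ) {f₀ f₁ : I → ℂ}
    (hf₀ : LinearIn ψ f₀) (hf₁ : LinearIn ψ f₁) (h₀ : ∃ p, f₀ p ≠ 0) (h₁ : ∃ p, f₁ p ≠ 0)
    (hne : ∀ p, f₀ p ≠ 0 ∨ f₁ p ≠ 0) :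
    ∃ r : I → ℂ, Implementable 1 (qubit (fun p => r p * f₀ p) fun p => r p * f₁ p) := by
  have hpos {f : I → ℂ} {w : (Fin n → Fin 2) → ℂ} (hw : ∀ p, f p = ∑ x, w x * ψ p x)
      (h : ∃ p, f p ≠ 0) : 0 < ∑ x, ‖w x‖ ^ 2 := by
    obtain ⟨p, hp⟩ := h
    rw [hw] at hp
    obtain ⟨x, -, hx⟩ := Finset.exists_ne_zero_of_sum_ne_zero hp
    have := left_ne_zero_of_mul hx
    exact Finset.sum_pos' (fun _ _ => by positivity) ⟨x, Finset.mem_univ _, by positivity⟩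
  obtain ⟨w₀, hw₀⟩ := hf₀
  obtain ⟨w₁, hw₁⟩ := hf₁
  -- The surviving basis states `y` do not depend on the state, so the unitary can be built around
  -- them.
  obtain ⟨y, hy, hall⟩ := exists_measure_all n
  let w : Fin 2 → (Fin n → Fin 2) → ℂ := ![w₀, w₁]
  let s : Fin 2 → ℝ := fun b => Real.sqrt (∑ x, ‖w b x‖ ^ 2)
  have hs (b) : 0 < s b := by
    refine Real.sqrt_pos.2 ?_
    fin_cases b
    exacts [hpos hw₀ h₀, hpos hw₁ h₁]
  have hs' (b) : (s b : ℂ) ≠ 0 := by exact_mod_cast (hs b).ne'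
  have hss (b) : (s b : ℂ) * s b = ∑ x, w b x * star (w b x) := by
    have : s b * s b = ∑ x, ‖w b x‖ ^ 2 :=
      Real.mul_self_sqrt (Finset.sum_nonneg fun _ _ => by positivity)
    rw [← Complex.ofReal_mul, this]
    simp [Complex.mul_conj']
  let v : Fin 2 → (Fin (n + 1) → Fin 2) → ℂ := fun b x =>
    if x (Fin.natAdd n 0) = b then w b (fun i => x (Fin.castAdd 1 i)) / s b else 0
  obtain ⟨U, hU, hUv⟩ := exists_unitary_rows (fun b => y fun _ => b)
    (fun b c h => congrFun (hy h) 0) v fun b c => by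
      rw [sum_append_one]
      simp only [v, Fin.append_left, Fin.append_right]
      by_cases hbc : b = c
      · subst hbc
        have h' (x) : w b x / s b * star (w b x / s b) = w b x * star (w b x) / (s b * s b) := by
          simp [div_mul_div_comm]
        simp only [ite_mul, zero_mul, Finset.sum_ite_eq', Finset.mem_univ,
          if_true, h', ← Finset.sum_div, ← hss]
        exact div_self (mul_ne_zero (hs' b) (hs' b))
      · rw [if_neg hbc]
        refine Finset.sum_eq_zero fun x _ => Finset.sum_eq_zero fun a _ => ?_
        by_cases hab : a = b
        · rw [if_neg (fun h => hbc (hab.symm.trans h)), star_zero, mul_zero]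
        · rw [if_neg hab, zero_mul]
  -- Normalizing divides `f₀` by `s 0` and `f₁` by `s 1`; the amplitude ratio `a` of the auxiliary
  -- qubit restores the common factor.
  obtain ⟨a, ha⟩ : ∃ a : ℂ, a = s 0 / s 1 := ⟨_, rfl⟩
  obtain ⟨N, hNa⟩ : ∃ N : ℂ, (Real.sqrt (‖a‖ ^ 2 + 1) : ℂ) = N := ⟨_, rfl⟩
  have hN : N ≠ 0 := by
    have : (0 : ℝ) < ‖a‖ ^ 2 + 1 := by positivity
    rw [← hNa]
    exact_mod_cast (Real.sqrt_pos.2 this).ne'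
  have hval (b : Fin 2) (p : I) : U.mulVec (tensor ψ (constQubit a) p) (y fun _ => b) =
      (s 1 * N)⁻¹ * if b = 0 then f₀ p else f₁ p := by
    rw [Matrix.mulVec, dotProduct, hUv, sum_append_one]
    simp only [v, tensor, constQubit, qubit, Fin.append_left, Fin.append_right, ite_mul, zero_mul,
      Finset.sum_ite_eq', Finset.mem_univ, if_true, hNa]
    have h0 := hs' 0
    have h1 := hs' 1
    fin_cases b
    · simp only [Fin.zero_eta, if_true, hw₀, Finset.mul_sum]
      refine Finset.sum_congr rfl fun x _ => ?_
      simp only [w, ha, Matrix.cons_val_zero]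
      field_simp
    · simp only [Fin.mk_one, one_ne_zero, if_false, hw₁, Finset.mul_sum]
      refine Finset.sum_congr rfl fun x _ => ?_
      simp only [w, Matrix.cons_val_one, Matrix.cons_val_zero]
      field_simp
  have hc : (s 1 * N)⁻¹ ≠ 0 := inv_ne_zero (mul_ne_zero (hs' 1) hN)
  obtain ⟨r, hr⟩ := hall _ ((hψ.tensor (.const a)).unitary U hU) fun p => by
    rcases hne p with h | h
    · exact ⟨fun _ => 0, by rw [hval]; exact mul_ne_zero hc h⟩
    · exact ⟨fun _ => 1, by rw [hval]; exact mul_ne_zero hc h⟩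
  refine ⟨fun p => r p * (s 1 * N)⁻¹, ?_⟩
  convert hr using 1
  ext p x
  have hx : x = fun _ => x 0 := funext fun i => by rw [Subsingleton.elim i 0]
  rw [hx, hval]
  simp only [qubit]
  split_ifs <;> ring

/-! ### Examples of simulable tuples -/

/-- The tuple is determined up to a phase by the ratio of its entries. -/
lemma simulableTuple_of_ratio {n : ℕ} {ψ : QFamily n} (hψ : Implementable n ψ) {f₀ f₁ : I → ℂ}
    (hf₀ : LinearIn ψ f₀) (hf₁ : LinearIn ψ f₁) (h₀ : ∃ p, f₀ p ≠ 0) (h₁ : ∀ p, f₁ p ≠ 0)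
    {k₀ k₁ : I → ℂ} (hk : ∀ p, ‖k₀ p‖ ^ 2 + ‖k₁ p‖ ^ 2 = 1)
    (hkf : ∀ p, k₀ p * f₁ p = k₁ p * f₀ p) : SimulableTuple k₀ k₁ := by
  refine ⟨hk, ?_⟩
  obtain ⟨r, hr⟩ := exists_implementable_qubit hψ hf₀ hf₁ h₀ ⟨0, h₁ 0⟩ fun p => .inr (h₁ p)
  have hn (p : I) : ‖r p * f₀ p‖ ^ 2 + ‖r p * f₁ p‖ ^ 2 = 1 := by
    rw [← hr.normSq_eq_one p, normSq_qubit]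
  have hr0 (p : I) : r p ≠ 0 := fun h => by simpa [h] using hn p
  -- This factor carries the prepared pair to `(k₀, k₁)`; both pairs are normalized, so it is a
  -- phase.
  let c : I → ℂ := fun p => k₁ p / (r p * f₁ p)
  have hc₁ (p : I) : c p * (r p * f₁ p) = k₁ p := div_mul_cancel₀ _ (mul_ne_zero (hr0 p) (h₁ p))
  have hc₀ (p : I) : c p * (r p * f₀ p) = k₀ p := by
    refine mul_right_cancel₀ (h₁ p) ?_
    rw [hkf, ← hc₁]
    ring
  have hc (p : I) : ‖c p‖ = 1 := by
    have := hk p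
    rw [← hc₀, ← hc₁, norm_mul, norm_mul (c p), mul_pow, mul_pow, ← mul_add, hn, mul_one] at this
    exact (pow_eq_one_iff_of_nonneg (norm_nonneg _) two_ne_zero).1 this
  convert hr.phase c hc using 1
  ext p x
  simp only [qubit, ← hc₀, ← hc₁]
  split_ifs <;> rfl

lemma linearIn_coin_sq : LinearIn (tensor coin coin) (fun p => ((p : ℝ) : ℂ)) ∧
    LinearIn (tensor coin coin) (fun p => ((1 - (p : ℝ) : ℝ) : ℂ)) ∧
    LinearIn (tensor coin coin) (fun p => ((Real.sqrt p * Real.sqrt (1 - p) : ℝ) : ℂ)) := by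
  have h0 : LinearIn coin (fun p => (Real.sqrt p : ℂ)) := .apply coin fun _ => 0
  have h1 : LinearIn coin (fun p => (Real.sqrt (1 - p) : ℂ)) := .apply coin fun _ => 1
  refine ⟨?_, ?_, ?_⟩
  · convert h0.mul h0 using 2 with p
    rw [← Complex.ofReal_mul, Real.mul_self_sqrt p.2.1]
  · convert h1.mul h1 using 2 with p
    rw [← Complex.ofReal_mul, Real.mul_self_sqrt (sub_nonneg.2 p.2.2)]
  · simpa using h0.mul h1

lemma sq_mem_QQ : (fun p : I => (p : ℝ) ^ 2) ∈ QQ := by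
  obtain ⟨h, h', h''⟩ := linearIn_coin_sq
  -- Chosen so that `‖f₁ p‖ ^ 2 = (1 - p) ^ 2 + 2 p (1 - p) = 1 - p ^ 2`; the pair `(p, f₁ p)` is
  -- then already normalized.
  let f₁ : I → ℂ := fun p => ((1 - (p : ℝ) : ℝ) : ℂ) +
    (Real.sqrt 2 * Complex.I) * ((Real.sqrt p * Real.sqrt (1 - p) : ℝ) : ℂ)
  have hf₁ : LinearIn (tensor coin coin) f₁ := h'.add (h''.const_mul _)
  have hn (p : I) : ‖f₁ p‖ ^ 2 = 1 - (p : ℝ) ^ 2 := by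
    have h0 := p.2.1
    have h1 : 0 ≤ 1 - (p : ℝ) := sub_nonneg.2 p.2.2
    have : f₁ p = ⟨1 - p, Real.sqrt 2 * (Real.sqrt p * Real.sqrt (1 - p))⟩ := by
      apply Complex.ext <;> simp [f₁]
    rw [this, Complex.sq_norm, Complex.normSq_mk]
    have e1 := Real.mul_self_sqrt h0
    have e2 := Real.mul_self_sqrt h1
    have e3 := Real.mul_self_sqrt (show (0 : ℝ) ≤ 2 by norm_num)
    calc _ = (1 - (p : ℝ)) * (1 - p) + (Real.sqrt 2 * Real.sqrt 2) *
          ((Real.sqrt p * Real.sqrt p) * (Real.sqrt (1 - p) * Real.sqrt (1 - p))) := by ring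
      _ = _ := by rw [e1, e2, e3]; ring
  obtain ⟨r, hr⟩ := exists_implementable_qubit (.tensor .coin .coin) h hf₁ ⟨1, by simp⟩
    ⟨0, fun h => by simpa [h] using hn 0⟩ fun p => by
      by_contra! hp
      have := hn p
      have h0 : (p : ℝ) = 0 := by exact_mod_cast hp.1
      simp [hp.2, h0] at this
  have hnorm (p : I) : ‖r p * ((p : ℝ) : ℂ)‖ ^ 2 + ‖r p * f₁ p‖ ^ 2 = 1 := by
    rw [← hr.normSq_eq_one p, normSq_qubit]
  refine ⟨_, _, ⟨hnorm, hr⟩, fun p => ?_⟩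
  have := hnorm p
  rw [norm_mul, norm_mul, mul_pow, mul_pow, hn, Complex.norm_real, Real.norm_eq_abs, sq_abs] at this
  rw [norm_mul, mul_pow, Complex.norm_real, Real.norm_eq_abs, sq_abs]
  linear_combination -(p : ℝ) ^ 2 * this

/-- The constant `1 = p + (1 - p)` is carried through the induction: it supplies the constant term
of each factor and finally the denominator of the ratio. -/
lemma exists_linearIn_prod {n : ℕ} (c : Fin n → ℝ) : ∃ (m : ℕ) (ψ : QFamily m),
    Implementable m ψ ∧ LinearIn ψ (fun p => ∏ i, (((p : ℝ) : ℂ) - (c i : ℂ))) ∧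
      LinearIn ψ fun _ => 1 := by
  obtain ⟨h, h', -⟩ := linearIn_coin_sq
  have h1 : LinearIn (tensor coin coin) fun _ => 1 := by
    convert h.add h' using 2 with p
    push_cast
    ring
  induction n with
  | zero => exact ⟨_, _, .tensor .coin .coin, by simpa using h1, h1⟩
  | succ n ih =>
    obtain ⟨m, ψ, hψ, hf, hg⟩ := ih fun i => c i.succ
    refine ⟨_, _, .tensor (.tensor .coin .coin) hψ, ?_, by simpa using h1.mul hg⟩
    convert (h.add (h1.const_mul (-(c 0 : ℂ)))).mul hf using 2 with p
    rw [Fin.prod_univ_succ]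
    ring

lemma simulableTuple_of_prod {n : ℕ} (c : Fin n → ℝ) (hc : ∀ i, c i ∈ Set.Ioo (0 : ℝ) 1)
    {k₀ k₁ : I → ℂ} (hk : ∀ p, ‖k₀ p‖ ^ 2 + ‖k₁ p‖ ^ 2 = 1)
    (hkf : ∀ p, k₁ p ≠ 0 ∧ k₀ p / k₁ p = ∏ i, (((p : ℝ) : ℂ) - (c i : ℂ))) :
    SimulableTuple k₀ k₁ := by
  obtain ⟨m, ψ, hψ, hf, hg⟩ := exists_linearIn_prod c
  refine simulableTuple_of_ratio hψ hf hg ⟨0, ?_⟩ (by simp) hk fun p => ?_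
  · refine Finset.prod_ne_zero_iff.2 fun i _ => ?_
    simpa using (hc i).1.ne'
  · rw [← (hkf p).2, mul_div_cancel₀ _ (hkf p).1, mul_one]

lemma normSq_eq_of_ratio {k₀ k₁ R : ℂ} (hk : ‖k₀‖ ^ 2 + ‖k₁‖ ^ 2 = 1) (h₁ : k₁ ≠ 0)
    (h : k₀ / k₁ = R) : ‖k₀‖ ^ 2 = ‖R‖ ^ 2 / (1 + ‖R‖ ^ 2) := by
  rw [div_eq_iff h₁] at h
  subst h
  rw [norm_mul, mul_pow] at *
  rw [eq_div_iff (by positivity)]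
  linear_combination ‖R‖ ^ 2 * hk

lemma prod_ratio_notMem_CC {n : ℕ} (c : Fin n → ℝ) (hn : 1 ≤ n)
    (hc : ∀ i, c i ∈ Set.Ioo (0 : ℝ) 1) :
    (fun p : I => |∏ i, ((p : ℝ) - c i)| ^ 2 / (1 + |∏ i, ((p : ℝ) - c i)| ^ 2)) ∉ CC := by
  intro h
  have hc0 := hc ⟨0, hn⟩
  have h0 := eq_zero_of_mem_CC h (p := ⟨c ⟨0, hn⟩, hc0.1.le, hc0.2.le⟩) hc0.1 hc0.2
    (by simp [Finset.prod_eq_zero (Finset.mem_univ (⟨0, hn⟩ : Fin n))]) 0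
  have hne : ∏ i, (((0 : I) : ℝ) - c i) ≠ 0 :=
    Finset.prod_ne_zero_iff.2 fun i _ => by simpa using (hc i).1.ne'
  have hpos : 0 < |∏ i, (((0 : I) : ℝ) - c i)| := abs_pos.2 hne
  exact absurd h0 (by positivity)

lemma norm_prod_sub {n : ℕ} (c : Fin n → ℝ) (p : ℝ) :
    ‖∏ i, ((p : ℂ) - (c i : ℂ))‖ = |∏ i, (p - c i)| := by
  rw [← Real.norm_eq_abs, ← Complex.norm_real]
  push_cast
  rfl

lemma prod_ratio_mem_QQ {n : ℕ} (c : Fin n → ℝ) (hc : ∀ i, c i ∈ Set.Ioo (0 : ℝ) 1) :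
    (fun p : I => |∏ i, ((p : ℝ) - c i)| ^ 2 / (1 + |∏ i, ((p : ℝ) - c i)| ^ 2)) ∈ QQ := by
  let R : I → ℂ := fun p => ∏ i, (((p : ℝ) : ℂ) - (c i : ℂ))
  have hpos (p : I) : (0 : ℝ) < 1 + ‖R p‖ ^ 2 := by positivity
  have hs (p : I) : (Real.sqrt (1 + ‖R p‖ ^ 2) : ℂ) ≠ 0 := by
    exact_mod_cast (Real.sqrt_pos.2 (hpos p)).ne'
  let k₁ : I → ℂ := fun p => (Real.sqrt (1 + ‖R p‖ ^ 2) : ℂ)⁻¹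
  have hk₁ (p : I) : k₁ p ≠ 0 := inv_ne_zero (hs p)
  have hk (p : I) : ‖R p * k₁ p‖ ^ 2 + ‖k₁ p‖ ^ 2 = 1 := by
    have : ‖k₁ p‖ ^ 2 = (1 + ‖R p‖ ^ 2)⁻¹ := by
      simp [k₁, Real.sq_sqrt (hpos p).le]
    rw [norm_mul, mul_pow, this]
    field_simp [(hpos p).ne']
    ring
  refine ⟨fun p => R p * k₁ p, k₁, simulableTuple_of_prod c hc hk fun p =>
    ⟨hk₁ p, mul_div_cancel_right₀ _ (hk₁ p)⟩, fun p => ?_⟩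
  rw [normSq_eq_of_ratio (hk p) (hk₁ p) (mul_div_cancel_right₀ _ (hk₁ p)), norm_prod_sub]

/-! ### Prepared states depend analytically on the bias -/

/-- Up to a factor, the amplitudes of a prepared state are real analytic functions of the angle
`arcsin √p`. -/
lemma Implementable.exists_analytic {n : ℕ} {ψ : QFamily n} (h : Implementable n ψ) :
    ∃ (c : I → ℂ) (g : (Fin n → Fin 2) → ℝ → ℂ), (∀ x, AnalyticOnNhd ℝ (g x) Set.univ) ∧
      ∀ p x, ψ p x = c p * g x (Real.arcsin (Real.sqrt p)) := by
  have hconst (a : ℂ) : AnalyticOnNhd ℝ (fun _ : ℝ => a) Set.univ := analyticOnNhd_const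
  induction h with
  | coin =>
    -- At `θ = arcsin √p` the coin is `sin θ |0⟩ + cos θ |1⟩`; the angle removes the singularities
    -- of the square roots at the endpoints.
    refine ⟨fun _ => 1, fun x t => if x 0 = 0 then (Real.sin t : ℂ) else (Real.cos t : ℂ),
      fun x => ?_, fun p x => ?_⟩
    · dsimp only
      split_ifs
      · exact fun t _ => (Complex.ofRealCLM.analyticAt _).comp Real.analyticAt_sin
      · exact fun t _ => (Complex.ofRealCLM.analyticAt _).comp Real.analyticAt_cos
    · have h0 := Real.sqrt_nonneg p
      have h1 : Real.sqrt p ≤ 1 := Real.sqrt_le_one.2 p.2.2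
      dsimp only
      rw [Real.sin_arcsin (by linarith) h1, Real.cos_arcsin, Real.sq_sqrt p.2.1, one_mul]
      rfl
  | const a =>
    exact ⟨fun _ => 1, fun x _ => constQubit a 0 x, fun x => hconst _,
      fun p x => by simp [constQubit, qubit]⟩
  | @tensor m n _ _ _ _ hψ hφ =>
    obtain ⟨c, g, hg, h⟩ := hψ
    obtain ⟨c', g', hg', h'⟩ := hφ
    refine ⟨fun p => c p * c' p, fun x t =>
      g (fun i => x (Fin.castAdd n i)) t * g' (fun j => x (Fin.natAdd m j)) t,
      fun x => (hg _).mul (hg' _), fun p x => ?_⟩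
    rw [BernoulliFactory.tensor, h, h']
    ring
  | unitary U _ _ hψ =>
    obtain ⟨c, g, hg, h⟩ := hψ
    refine ⟨c, fun x t => ∑ y, U x y * g y t, fun x => ?_, fun p x => ?_⟩
    · exact Finset.analyticOnNhd_fun_sum _ fun y _ => (hconst _).mul (hg y)
    · simp only [Matrix.mulVec, dotProduct, h, Finset.mul_sum]
      exact Finset.sum_congr rfl fun y _ => by ring
  | @measure m φ i b _ _ hψ =>
    obtain ⟨c, g, hg, h⟩ := hψ
    -- The normalization goes into the unrestricted factor `c`, so the analytic part is merely
    -- reindexed.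
    refine ⟨fun p => c p / (Real.sqrt (normSq (project i b φ) p) : ℂ), fun x => g (i.insertNth b x),
      fun x => hg _, fun p x => ?_⟩
    simp only [project, h]
    ring
  | phase c' _ _ hψ =>
    obtain ⟨c, g, hg, h⟩ := hψ
    refine ⟨fun p => c' p * c p, g, hg, fun p x => ?_⟩
    dsimp only
    rw [h, mul_assoc]

/-- A function in `QQ` that is `1/2` on an interval is `1/2` everywhere. -/
lemma eq_half_of_mem_QQ {f : I → ℝ} (hf : f ∈ QQ) (h : ∀ p : I, (p : ℝ) < 1 / 2 → f p = 1 / 2)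
    (p : I) : f p = 1 / 2 := by
  obtain ⟨k₀, k₁, ⟨hk, himp⟩, hfk⟩ := hf
  obtain ⟨c, g, hg, hgk⟩ := himp.exists_analytic
  have h₀ (p : I) : k₀ p = c p * g (fun _ => 0) (Real.arcsin (Real.sqrt p)) := by
    rw [← hgk]; simp [qubit]
  have h₁ (p : I) : k₁ p = c p * g (fun _ => 1) (Real.arcsin (Real.sqrt p)) := by
    rw [← hgk]; simp [qubit]
  have han (x) : AnalyticOnNhd ℝ (fun t => ‖g x t‖ ^ 2) Set.univ := by
    have : (fun t => ‖g x t‖ ^ 2) = fun t => (g x t).re * (g x t).re + (g x t).im * (g x t).im := by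
      ext t; rw [Complex.sq_norm, Complex.normSq_apply]
    rw [this]
    intro t ht
    have hre : AnalyticAt ℝ (fun t => (g x t).re) t :=
      (Complex.reCLM.analyticAt _).comp (hg x t ht)
    have him : AnalyticAt ℝ (fun t => (g x t).im) t :=
      (Complex.imCLM.analyticAt _).comp (hg x t ht)
    exact (hre.mul hre).add (him.mul him)
  -- The factor `c` cancels when the two outcomes are compared. Angles in `(0, π/4)` correspond to
  -- biases `sin² t < 1/2`, and `π/8` is the midpoint.
  have hloc : (fun t => ‖g (fun _ => 0) t‖ ^ 2) =ᶠ[nhds (Real.pi / 8)]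
      fun t => ‖g (fun _ => 1) t‖ ^ 2 := by
    have hpi := Real.pi_pos
    filter_upwards [Ioo_mem_nhds (show 0 < Real.pi / 8 by linarith)
      (show Real.pi / 8 < Real.pi / 4 by linarith)] with t ht
    have hs0 : 0 < Real.sin t := Real.sin_pos_of_pos_of_lt_pi ht.1 (by linarith [ht.2])
    have hs1 : Real.sin t ^ 2 < 1 / 2 := by
      have h1 : Real.sin t < Real.sin (Real.pi / 4) :=
        Real.sin_lt_sin_of_lt_of_le_pi_div_two (by linarith [ht.1]) (by linarith) ht.2
      have h2 := pow_lt_pow_left₀ h1 hs0.le two_ne_zero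
      rw [Real.sin_pi_div_four, div_pow, Real.sq_sqrt (by norm_num)] at h2
      linarith
    let q : I := ⟨Real.sin t ^ 2, by positivity, by linarith⟩
    have hq : Real.arcsin (Real.sqrt q) = t := by
      rw [show (q : ℝ) = Real.sin t ^ 2 from rfl, Real.sqrt_sq hs0.le,
        Real.arcsin_sin (by linarith [ht.1]) (by linarith [ht.2])]
    have e0 : ‖k₀ q‖ ^ 2 = 1 / 2 := by rw [← hfk, h q hs1]
    have e1 : ‖k₁ q‖ ^ 2 = 1 / 2 := by linarith [hk q]
    rw [h₀, hq, norm_mul, mul_pow] at e0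
    rw [h₁, hq, norm_mul, mul_pow] at e1
    have hc : ‖c q‖ ^ 2 ≠ 0 := fun h => by norm_num [h] at e0
    exact mul_left_cancel₀ hc (e0.trans e1.symm)
  have hall := (han _).eqOn_of_preconnected_of_eventuallyEq (han _) isPreconnected_univ
    (Set.mem_univ _) hloc (Set.mem_univ (Real.arcsin (Real.sqrt p)))
  have := hk p
  have heq : ‖k₀ p‖ ^ 2 = ‖k₁ p‖ ^ 2 := by
    rw [h₀, h₁, norm_mul, norm_mul, mul_pow, mul_pow]
    exact congrArg _ hall
  rw [hfk]
  linarith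

lemma piecewise_notMem_QQ :
    (fun p : I => if (p : ℝ) < 1 / 2 then (1 / 2 : ℝ) else 1 / 2 * (p : ℝ) + 1 / 4) ∉ QQ := by
  intro h
  -- At `p = 1` the function takes the value `3/4`.
  have := eq_half_of_mem_QQ h (fun p hp => if_pos hp) 1
  norm_num at this

end BernoulliFactory

theorem mainTheorem3 :
    -- the two sets overlap
    (BernoulliFactory.CC ∩ BernoulliFactory.QQ).Nonempty ∧
    (fun p : I => (p : ℝ) ^ 2) ∈ BernoulliFactory.CC ∩ BernoulliFactory.QQ ∧
    -- functions in QQ that are not in CC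
    (∀ (n : ℕ) (c : Fin n → ℝ), 1 ≤ n → (∀ i, c i ∈ Set.Ioo (0 : ℝ) 1) →
      (∀ k₀ k₁ : I → ℂ, (∀ p, ‖k₀ p‖ ^ 2 + ‖k₁ p‖ ^ 2 = 1) →
        (∀ p, k₁ p ≠ 0 ∧ k₀ p / k₁ p = ∏ i, (((p : ℝ) : ℂ) - (c i : ℂ))) →
        BernoulliFactory.SimulableTuple k₀ k₁ ∧
        (fun p => ‖k₀ p‖ ^ 2) ∉ BernoulliFactory.CC) ∧
      (fun p : I => |∏ i, ((p : ℝ) - c i)| ^ 2 / (1 + |∏ i, ((p : ℝ) - c i)| ^ 2)) ∈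
        BernoulliFactory.QQ ∧
      (fun p : I => |∏ i, ((p : ℝ) - c i)| ^ 2 / (1 + |∏ i, ((p : ℝ) - c i)| ^ 2)) ∉
        BernoulliFactory.CC) ∧
    ¬ BernoulliFactory.QQ ⊆ BernoulliFactory.CC ∧
    -- a function in CC that is not in QQ
    (fun p : I => if (p : ℝ) < 1 / 2 then (1 / 2 : ℝ) else 1 / 2 * (p : ℝ) + 1 / 4) ∈
      BernoulliFactory.CC ∧
    (fun p : I => if (p : ℝ) < 1 / 2 then (1 / 2 : ℝ) else 1 / 2 * (p : ℝ) + 1 / 4) ∉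
      BernoulliFactory.QQ ∧
    ¬ BernoulliFactory.CC ⊆ BernoulliFactory.QQ := by
  have hpart : ∀ (n : ℕ) (c : Fin n → ℝ), 1 ≤ n → (∀ i, c i ∈ Set.Ioo (0 : ℝ) 1) →
      (fun p : I => |∏ i, ((p : ℝ) - c i)| ^ 2 / (1 + |∏ i, ((p : ℝ) - c i)| ^ 2)) ∈
        BernoulliFactory.QQ ∧
      (fun p : I => |∏ i, ((p : ℝ) - c i)| ^ 2 / (1 + |∏ i, ((p : ℝ) - c i)| ^ 2)) ∉
        BernoulliFactory.CC := fun n c hn hc =>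
    ⟨BernoulliFactory.prod_ratio_mem_QQ c hc, BernoulliFactory.prod_ratio_notMem_CC c hn hc⟩
  have hsq : (fun p : I => (p : ℝ) ^ 2) ∈ BernoulliFactory.CC ∩ BernoulliFactory.QQ :=
    ⟨BernoulliFactory.sq_mem_CC, BernoulliFactory.sq_mem_QQ⟩
  refine ⟨⟨_, hsq⟩, hsq, fun n c hn hc => ⟨fun k₀ k₁ hk hkf => ⟨?_, ?_⟩, hpart n c hn hc⟩,
    fun hsub => ?_, BernoulliFactory.piecewise_mem_CC, BernoulliFactory.piecewise_notMem_QQ,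
    fun hsub => BernoulliFactory.piecewise_notMem_QQ (hsub BernoulliFactory.piecewise_mem_CC)⟩
  · exact BernoulliFactory.simulableTuple_of_prod c hc hk hkf
  · convert (hpart n c hn hc).2 using 3 with p
    rw [BernoulliFactory.normSq_eq_of_ratio (hk p) (hkf p).1 (hkf p).2,
      BernoulliFactory.norm_prod_sub]
  · have := hpart 1 (fun _ => 1 / 2) le_rfl fun _ => by norm_num
    exact this.2 (hsub this.1)
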